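/- **Definitions.** An *oriented graph* is a finite digraph without loops and without opposite arcs. For vertex-disjoint digraphs $G_1,\dots,G_k$ ($k\ge 1$), the *disjoint union* $G_1\oplus\cdots\oplus G_k$ has as vertices and arcs the union of the vertices and arcs of the $G_i$, and the *order composition* $G_1\oslash\cdots\oslash G_k$ is the disjoint union together with all arcs from vertices of $G_i$ to vertices of $G_j$ for all $i<j$. The *oriented co-graphs* are the digraphs obtained from single vertices (without arcs) by repeatedly applying these two operations. For a finite nonempty digraph $G$, $\ell(G)$ denotes the length (number of arcs) of a longest oriented path in $G$, that is, of a longest directed path with pairwise distinct vertices (not necessarily induced); so $\ell(G)=0$ if $G$ has no arcs. **Theorem.** Let $G=(V,A)$ be an oriented co-graph. Then $\ell(G)$ can be computed in linear time. Precisely: there are one program for a unit-cost random access machine (elementary instructions: constants, copying, addition, truncated subtraction, comparison, and indirect load and store) and a constant $c$ such that for every oriented co-graph $G=(V,A)$ with $V=\{0,\dots,n-1\}$ and $m=|A|$, given as the word sequence $n,m,u_1,v_1,\dots,u_m,v_m$ in which $(u_1,v_1),\dots,(u_m,v_m)$ are the arcs of $G$ in arbitrary order, each listed once, the program halts after at most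 $c\,(n+m)$ steps with output $\ell(G)$, and all numbers that it produces during the run are at most $c\,(n+m)$ (so they are words of $O(\log(n+m))$ bits). Moreover, for vertex-disjoint nonempty oriented graphs $G_1,\dots,G_k$, $k\ge 1$, $$\ell(G_1\oplus\cdots\oplus G_k)=\max_{1\le i\le k}\ell(G_i),\qquad \ell(G_1\oslash\cdots\oslash G_k)=\sum_{i=1}^k\ell(G_i)+k-1 .$$ -/

import Mathlib

universe u

/-! ## Digraphs and oriented co-graphs -/

/-- An oriented graph is a digraph with no loops and no opposite arcs. -/
def Digraph.IsOriented {V : Type u} (G : Digraph V) : Prop :=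
  (∀ v, ¬ G.Adj v v) ∧ ∀ v w, G.Adj v w → ¬ G.Adj w v

/-- The disjoint union of the digraphs `G i`. Vertex-disjointness is built into the vertex type,
whose elements are the pairs `⟨i, a⟩` with `a` a vertex of `G i`. -/
def Digraph.disjointUnion {k : ℕ} {V : Fin k → Type u} (G : ∀ i, Digraph (V i)) :
    Digraph (Σ i, V i) where
  Adj p q := ∃ i a b, (G i).Adj a b ∧ p = ⟨i, a⟩ ∧ q = ⟨i, b⟩

/-- The order composition of the digraphs `G i`: their disjoint union plus all arcs
from vertices of `G i` to vertices of `G j` for all `i < j`. -/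
def Digraph.orderComposition {k : ℕ} {V : Fin k → Type u} (G : ∀ i, Digraph (V i)) :
    Digraph (Σ i, V i) where
  Adj p q := (Digraph.disjointUnion G).Adj p q ∨ p.1 < q.1

/-- Oriented co-graphs: the digraphs obtained from single vertices by disjoint unions and order
compositions. Since `Sigma` types give the compositions on one concrete copy of the vertex set,
the class is closed under isomorphism explicitly. -/
inductive IsOrientedCograph : ∀ {V : Type u}, Digraph V → Prop
  | single {V : Type u} [Unique V] (G : Digraph V) (noArc : ∀ v w, ¬ G.Adj v w) :
      IsOrientedCograph G
  | union {k : ℕ} (hk : 1 ≤ k) {V : Fin k → Type u} (G : ∀ i, Digraph (V i))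
      (h : ∀ i, IsOrientedCograph (G i)) : IsOrientedCograph (Digraph.disjointUnion G)
  | order {k : ℕ} (hk : 1 ≤ k) {V : Fin k → Type u} (G : ∀ i, Digraph (V i))
      (h : ∀ i, IsOrientedCograph (G i)) : IsOrientedCograph (Digraph.orderComposition G)
  | iso {V W : Type u} {G : Digraph V} {H : Digraph W} (e : G.Adj ≃r H.Adj)
      (h : IsOrientedCograph G) : IsOrientedCograph H

/-! ## Longest oriented paths -/

/-- `p` is the vertex sequence of an oriented path with `k` arcs (on `k + 1` distinct vertices)
in `G`. -/
def Digraph.IsPathOfLength {V : Type u} (G : Digraph V) (p : List V) (k : ℕ) : Prop :=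
  p.IsChain G.Adj ∧ p.Nodup ∧ p.length = k + 1

/-- The length (number of arcs) of a longest oriented path; a genuine maximum for every finite
nonempty digraph, see `Digraph.longestPathLength_isGreatest`. -/
noncomputable def Digraph.longestPathLength {V : Type u} (G : Digraph V) : ℕ :=
  sSup {k | ∃ p, G.IsPathOfLength p k}

theorem Digraph.longestPathLength_isGreatest {V : Type u} [Finite V] [Nonempty V]
    (G : Digraph V) : IsGreatest {k | ∃ p, G.IsPathOfLength p k} G.longestPathLength := by
  have hb : BddAbove {k | ∃ p, G.IsPathOfLength p k} := by
    refine ⟨Nat.card V, ?_⟩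
    rintro k ⟨p, -, hnd, hl⟩
    have := Fintype.ofFinite V
    have := hnd.length_le_card
    rw [Nat.card_eq_fintype_card]
    omega
  have hne : {k | ∃ p, G.IsPathOfLength p k}.Nonempty :=
    ⟨0, [Classical.arbitrary V], by simp [Digraph.IsPathOfLength]⟩
  exact ⟨Nat.sSup_mem hne hb, fun k hk => le_csSup hb hk⟩

/-! ## A random access machine with bounded words and unit cost

A state consists of registers and of a memory of numbered cells; both hold natural numbers. A program
names finitely many registers; memory is reached by indirect addressing. Every elementary
instruction and every evaluation of a test costs one step. The machine has a word capacity `W`: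
an instruction that would produce a number larger than `W` cannot be executed, so that a run
with capacity `W` only ever produces words of at most `log₂ W + 1` bits. -/

structure RAM.State where
  reg : ℕ → ℕ
  mem : ℕ → ℕ

namespace RAM

inductive Program
  /-- `R[r] := k` -/
  | const (r k : ℕ)
  /-- `R[r] := R[s]` -/
  | copy (r s : ℕ)
  /-- `R[r] := R[s] + R[t]` -/
  | plus (r s t : ℕ)
  /-- `R[r] := max (R[s] - R[t]) 0` -/
  | minus (r s t : ℕ)
  /-- `R[r] := M[R[s]]` -/
  | load (r s : ℕ)
  /-- `M[R[r]] := R[s]` -/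
  | store (r s : ℕ)
  /-- first `P`, then `Q` -/
  | seq (P Q : Program)
  /-- if `R[r] < R[s]` then `P` else `Q` -/
  | ifLt (r s : ℕ) (P Q : Program)
  /-- while `R[r] < R[s]` do `P` -/
  | whileLt (r s : ℕ) (P : Program)

def State.setReg (σ : State) (r x : ℕ) : State :=
  { σ with reg := Function.update σ.reg r x }

def State.setMem (σ : State) (a x : ℕ) : State :=
  { σ with mem := Function.update σ.mem a x }

/-- `Exec W P σ t σ'`: on a machine with word capacity `W`, the program `P` started in state `σ`
halts after exactly `t` steps in state `σ'`. -/
inductive Exec (W : ℕ) : Program → State → ℕ → State → Prop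
  | const {σ : State} {r k : ℕ} (hW : k ≤ W) : Exec W (.const r k) σ 1 (σ.setReg r k)
  | copy {σ : State} {r s : ℕ} (hW : σ.reg s ≤ W) :
      Exec W (.copy r s) σ 1 (σ.setReg r (σ.reg s))
  | plus {σ : State} {r s t : ℕ} (hW : σ.reg s + σ.reg t ≤ W) :
      Exec W (.plus r s t) σ 1 (σ.setReg r (σ.reg s + σ.reg t))
  | minus {σ : State} {r s t : ℕ} (hW : σ.reg s - σ.reg t ≤ W) :
      Exec W (.minus r s t) σ 1 (σ.setReg r (σ.reg s - σ.reg t))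
  | load {σ : State} {r s : ℕ} (ha : σ.reg s ≤ W) (hW : σ.mem (σ.reg s) ≤ W) :
      Exec W (.load r s) σ 1 (σ.setReg r (σ.mem (σ.reg s)))
  | store {σ : State} {r s : ℕ} (ha : σ.reg r ≤ W) (hW : σ.reg s ≤ W) :
      Exec W (.store r s) σ 1 (σ.setMem (σ.reg r) (σ.reg s))
  | seq {σ σ₁ σ₂ : State} {P Q : Program} {t₁ t₂ : ℕ} (h₁ : Exec W P σ t₁ σ₁)
      (h₂ : Exec W Q σ₁ t₂ σ₂) : Exec W (.seq P Q) σ (t₁ + t₂) σ₂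
  | ifTrue {σ σ₁ : State} {r s : ℕ} {P Q : Program} {t : ℕ} (hc : σ.reg r < σ.reg s)
      (h : Exec W P σ t σ₁) : Exec W (.ifLt r s P Q) σ (t + 1) σ₁
  | ifFalse {σ σ₁ : State} {r s : ℕ} {P Q : Program} {t : ℕ} (hc : ¬ σ.reg r < σ.reg s)
      (h : Exec W Q σ t σ₁) : Exec W (.ifLt r s P Q) σ (t + 1) σ₁
  | whileTrue {σ σ₁ σ₂ : State} {r s : ℕ} {P : Program} {t₁ t₂ : ℕ}
      (hc : σ.reg r < σ.reg s) (h₁ : Exec W P σ t₁ σ₁)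
      (h₂ : Exec W (.whileLt r s P) σ₁ t₂ σ₂) :
      Exec W (.whileLt r s P) σ (t₁ + t₂ + 1) σ₂
  | whileFalse {σ : State} {r s : ℕ} {P : Program} (hc : ¬ σ.reg r < σ.reg s) :
      Exec W (.whileLt r s P) σ 1 σ

/-- The machine is deterministic: running time and final state are unique. -/
theorem Exec.deterministic {W : ℕ} {P : Program} {σ σ₁ σ₂ : State} {t₁ t₂ : ℕ}
    (h₁ : Exec W P σ t₁ σ₁) (h₂ : Exec W P σ t₂ σ₂) : t₁ = t₂ ∧ σ₁ = σ₂ := by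
  induction h₁ generalizing t₂ σ₂ with
  | const | copy | plus | minus | load | store => cases h₂; exact ⟨rfl, rfl⟩
  | seq _ _ ih₁ ih₂ =>
    cases h₂ with
    | seq a b =>
      obtain ⟨rfl, rfl⟩ := ih₁ a
      obtain ⟨rfl, rfl⟩ := ih₂ b
      exact ⟨rfl, rfl⟩
  | ifTrue hc _ ih =>
    cases h₂ with
    | ifTrue _ a =>
      obtain ⟨rfl, rfl⟩ := ih a
      exact ⟨rfl, rfl⟩
    | ifFalse hc' _ => exact absurd hc hc'
  | ifFalse hc _ ih =>
    cases h₂ with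
    | ifTrue hc' _ => exact absurd hc' hc
    | ifFalse _ a =>
      obtain ⟨rfl, rfl⟩ := ih a
      exact ⟨rfl, rfl⟩
  | whileTrue hc _ _ ih₁ ih₂ =>
    cases h₂ with
    | whileTrue _ a b =>
      obtain ⟨rfl, rfl⟩ := ih₁ a
      obtain ⟨rfl, rfl⟩ := ih₂ b
      exact ⟨rfl, rfl⟩
    | whileFalse hc' => exact absurd hc hc'
  | whileFalse hc =>
    cases h₂ with
    | whileTrue hc' _ _ => exact absurd hc' hc
    | whileFalse => exact ⟨rfl, rfl⟩

/-- The start state on input `w`: the words of `w` stand in the memory cells `0, 1, 2, …`,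
all other cells and all registers are zero. -/
def State.init (w : List ℕ) : State where
  reg _ := 0
  mem a := w.getD a 0

end RAM

/-! ## Digraphs as inputs -/

/-- `arcs` lists every arc of `G` exactly once, in an arbitrary order. -/
def Digraph.IsArcList {n : ℕ} (G : Digraph (Fin n)) (arcs : List (Fin n × Fin n)) : Prop :=
  arcs.Nodup ∧ ∀ v w, (v, w) ∈ arcs ↔ G.Adj v w

/-- The input words `n, m, u₁, v₁, …, uₘ, vₘ` for a digraph with the vertices `0, …, n - 1`
and the arcs `(u₁, v₁), …, (uₘ, vₘ)`. -/
def digraphInput (n : ℕ) (arcs : List (Fin n × Fin n)) : List ℕ :=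
  n :: arcs.length :: arcs.flatMap fun a => [(a.1 : ℕ), (a.2 : ℕ)]

/-! ### Longest paths in disjoint unions and order compositions -/

namespace Digraph

variable {k : ℕ} {V : Fin k → Type u}

/-! In a disjoint union a path stays in one component. In an order composition it meets the
components in increasing order and never returns to one, so it splits into one possibly empty path
per component. Counting vertices, which add up without the connecting arcs, gives the upper bound;
concatenating longest paths attains it (`component_chain`, `sum_length_component`).

The algorithm needs no decomposition tree. Both operations preserve irreflexivity and transitivity,
so the arc relation of an oriented co-graph is a strict partial order (`IsOrientedCograph.irrefl`,
`IsOrientedCograph.trans`). This has two consequences. Walks never repeat a vertex, so `ℓ(G)` is the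
length of a longest walk. And along an arc `(u, v)` the indegree strictly increases, because `u` and
all in-neighbours of `u` are in-neighbours of `v` (`IsOrientedCograph.indeg_lt_indeg`).

Indegrees are below `n`, so the arcs can be bucket-sorted by the indegree of their tails in linear
time. In this order no arc into a vertex is relaxed after an arc out of it, so relaxing every arc
once computes the longest walk ending in each vertex (`Relaxed.step`, `Relaxed.finish`). Each pass
handles an arc in constant time, and a potential argument bounds the last loop (`run_relaxLoop`). -/

theorem IsPathOfLength.le_longestPathLength {V : Type u} [Finite V] [Nonempty V] {G : Digraph V}
    {p : List V} {l : ℕ} (h : G.IsPathOfLength p l) : l ≤ G.longestPathLength :=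
  G.longestPathLength_isGreatest.2 ⟨p, h⟩

/-- Counting vertices instead of arcs admits the empty list, which is needed for components that a
path misses. -/
theorem length_le_of_isChain_nodup {V : Type u} [Finite V] [Nonempty V] {G : Digraph V}
    {p : List V} (hc : p.IsChain G.Adj) (hn : p.Nodup) : p.length ≤ G.longestPathLength + 1 := by
  rcases Nat.eq_zero_or_pos p.length with h | h
  · omega
  · have : G.IsPathOfLength p (p.length - 1) := ⟨hc, hn, by omega⟩
    have := this.le_longestPathLength
    omega

theorem exists_longest_path {V : Type u} [Finite V] [Nonempty V] (G : Digraph V) :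
    ∃ p, G.IsPathOfLength p G.longestPathLength :=
  G.longestPathLength_isGreatest.1

theorem disjointUnion_adj_mk {G : ∀ i, Digraph (V i)} {i : Fin k} {a b : V i} :
    (disjointUnion G).Adj ⟨i, a⟩ ⟨i, b⟩ ↔ (G i).Adj a b := by
  constructor
  · rintro ⟨j, a', b', h, h₁, h₂⟩
    cases h₁
    cases h₂
    exact h
  · intro h
    exact ⟨i, a, b, h, rfl, rfl⟩

theorem disjointUnion_adj_fst {G : ∀ i, Digraph (V i)} {x y : Σ i, V i}
    (h : (disjointUnion G).Adj x y) : x.1 = y.1 := by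
  obtain ⟨i, a, b, -, rfl, rfl⟩ := h
  rfl

theorem orderComposition_adj_mk {G : ∀ i, Digraph (V i)} {i : Fin k} {a b : V i} :
    (orderComposition G).Adj ⟨i, a⟩ ⟨i, b⟩ ↔ (G i).Adj a b := by
  simp [orderComposition, disjointUnion_adj_mk]

/-- The part in the `i`-th component of a list of vertices of a composition. -/
def component (i : Fin k) (p : List (Σ i, V i)) : List (V i) :=
  p.filterMap fun x => if h : x.1 = i then some (h ▸ x.2) else none

theorem component_cons_self (i : Fin k) (a : V i) (p : List (Σ i, V i)) :
    component i (⟨i, a⟩ :: p) = a :: component i p := by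
  simp [component]

theorem component_cons_ne {i : Fin k} {x : Σ i, V i} (h : x.1 ≠ i) (p : List (Σ i, V i)) :
    component i (x :: p) = component i p := by
  simp [component, h]

theorem nodup_component {p : List (Σ i, V i)} (h : p.Nodup) (i : Fin k) :
    (component i p).Nodup := by
  refine h.filterMap ?_
  rintro ⟨j, a⟩ ⟨j', a'⟩ b hb hb'
  simp only [Option.mem_def, Option.dite_none_right_eq_some, Option.some.injEq] at hb hb'
  obtain ⟨rfl, rfl⟩ := hb
  obtain ⟨rfl, h⟩ := hb'
  simpa using h.symm

theorem sum_length_component (p : List (Σ i, V i)) : ∑ i, (component i p).length = p.length := by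
  induction p with
  | nil => simp [component]
  | cons x p ih =>
    obtain ⟨j, a⟩ := x
    have : ∀ i, (component i (⟨j, a⟩ :: p)).length
        = (component i p).length + if j = i then 1 else 0 := by
      intro i
      by_cases h : j = i
      · subst h
        simp [component_cons_self]
      · simp [component_cons_ne (x := ⟨j, a⟩) h, h]
    simp [this, Finset.sum_add_distrib, ih]

/-- Neighbours in `component i p` need not be neighbours in `p`. The second clause closes this gap:
indices never decrease along the chain, so once it has left a component nothing of that component
follows. It is proved jointly to strengthen the induction. -/
theorem component_chain {G : ∀ i, Digraph (V i)} {p : List (Σ i, V i)}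
    (h : p.IsChain (orderComposition G).Adj) :
    (∀ i, (component i p).IsChain (G i).Adj) ∧ ∀ j a q, p = ⟨j, a⟩ :: q →
      ∀ i < j, component i p = [] := by
  induction p with
  | nil => simp [component]
  | cons x p ih =>
    obtain ⟨j, a⟩ := x
    obtain ⟨ih₁, ih₂⟩ := ih h.tail
    have key : ∀ i < j, component i p = [] := by
      intro i hi
      rcases p with - | ⟨⟨j', a'⟩, q⟩
      · simp [component]
      · refine ih₂ j' a' q rfl i (hi.trans_le ?_)
        rcases h.rel with h | h
        · exact (disjointUnion_adj_fst h).le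
        · exact h.le
    constructor
    · intro i
      by_cases hij : j = i
      · subst hij
        rw [component_cons_self]
        rcases p with - | ⟨⟨j', a'⟩, q⟩
        · simp [component]
        · have hr := h.rel
          by_cases hj : j' = j
          · subst hj
            have := ih₁ j'
            rw [component_cons_self] at this ⊢
            exact List.isChain_cons_cons.2 ⟨orderComposition_adj_mk.1 hr, this⟩
          · have hlt : j < j' := by
              rcases hr with h | h
              · exact absurd (disjointUnion_adj_fst h).symm hj
              · exact h
            rw [ih₂ j' a' q rfl j hlt]
            simp
      · rw [component_cons_ne (x := ⟨j, a⟩) hij]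
        exact ih₁ i
    · intro j' a' q hq i hi
      cases hq
      rw [component_cons_ne (x := ⟨j, a⟩) hi.ne']
      exact key i hi

theorem longestPathLength_orderComposition (hk : 1 ≤ k) [∀ i, Finite (V i)] [∀ i, Nonempty (V i)]
    (G : ∀ i, Digraph (V i)) :
    (orderComposition G).longestPathLength = (∑ i, (G i).longestPathLength) + (k - 1) := by
  have : Nonempty (Σ i, V i) := ⟨⟨⟨0, hk⟩, Classical.arbitrary _⟩⟩
  apply le_antisymm
  · obtain ⟨p, hc, hn, hl⟩ := exists_longest_path (orderComposition G)
    have h₁ : ∑ i, (component i p).length ≤ ∑ i, ((G i).longestPathLength + 1) :=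
      Finset.sum_le_sum fun i _ =>
        length_le_of_isChain_nodup ((component_chain hc).1 i) (nodup_component hn i)
    rw [sum_length_component, Finset.sum_add_distrib] at h₁
    simp at h₁
    omega
  · choose p hc hn hl using fun i => exists_longest_path (G i)
    let q : List (List (Σ i, V i)) := (List.finRange k).map fun i => (p i).map (Sigma.mk i)
    -- Empty blocks would break the chain criterion for `flatten`, which compares only consecutive
    -- blocks.
    have hne : [] ∉ q := by
      simp only [q, List.mem_map, not_exists, not_and, List.map_eq_nil_iff]
      intro i _ h
      have := hl i
      simp [h] at this
    have hchain : q.flatten.IsChain (orderComposition G).Adj := by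
      rw [List.isChain_flatten hne]
      constructor
      · intro l hl
        obtain ⟨i, -, rfl⟩ := List.mem_map.1 hl
        exact List.isChain_map_of_isChain _ (fun a b h => orderComposition_adj_mk.2 h) (hc i)
      · refine List.isChain_map_of_isChain (R := (· < ·)) _ ?_ ?_
        · intro i j hij x hx y hy
          have hx := List.mem_of_getLast? hx
          have hy := List.mem_of_head? hy
          obtain ⟨a, -, rfl⟩ := List.mem_map.1 hx
          obtain ⟨b, -, rfl⟩ := List.mem_map.1 hy
          exact Or.inr hij
        · exact (List.pairwise_lt_finRange k).isChain
    have hnodup : q.flatten.Nodup := by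
      rw [List.nodup_flatten]
      constructor
      · intro l hl
        obtain ⟨i, -, rfl⟩ := List.mem_map.1 hl
        exact (hn i).map sigma_mk_injective
      · refine List.Pairwise.map (R := (· < ·)) _ ?_ (List.pairwise_lt_finRange k)
        intro i j hij x hx hy
        obtain ⟨a, -, rfl⟩ := List.mem_map.1 hx
        obtain ⟨b, -, h⟩ := List.mem_map.1 hy
        exact hij.ne (congrArg Sigma.fst h).symm
    have hlen : q.flatten.length = (∑ i, (G i).longestPathLength) + k := by
      simp [q, List.length_flatten, Function.comp_def, hl, ← List.ofFn_eq_map, List.sum_ofFn,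
        Finset.sum_add_distrib]
    have := length_le_of_isChain_nodup hchain hnodup
    omega

theorem longestPathLength_disjointUnion (hk : 1 ≤ k) [∀ i, Finite (V i)] [∀ i, Nonempty (V i)]
    (G : ∀ i, Digraph (V i)) :
    (disjointUnion G).longestPathLength = Finset.univ.sup fun i => (G i).longestPathLength := by
  have : Nonempty (Σ i, V i) := ⟨⟨⟨0, hk⟩, Classical.arbitrary _⟩⟩
  apply le_antisymm
  · obtain ⟨p, hc, hn, hl⟩ := exists_longest_path (disjointUnion G)
    rcases p with - | ⟨⟨i, a⟩, p⟩
    · simp at hl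
    -- Equality of indices is transitive, so it passes from neighbours in the chain to all pairs.
    have hfst : ∀ y ∈ p, i = y.1 := by
      have : (Sigma.mk i a :: p).IsChain fun x y => x.1 = y.1 :=
        hc.imp fun _ _ => disjointUnion_adj_fst
      have : IsTrans (Σ i, V i) fun x y => x.1 = y.1 := ⟨fun _ _ _ => Eq.trans⟩
      exact (List.pairwise_cons.1 (List.isChain_iff_pairwise.1 ‹_›)).1
    obtain ⟨q, hq⟩ : ∃ q : List (V i), (⟨i, a⟩ :: p) = q.map (Sigma.mk i) := by
      have hp : ∀ y ∈ (Sigma.mk i a :: p), y ∈ Set.range (Sigma.mk i : V i → _) := by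
        intro y hy
        obtain ⟨j, b⟩ := y
        obtain rfl : i = j := by
          rcases List.mem_cons.1 hy with h | h
          · exact (congrArg Sigma.fst h).symm
          · exact hfst _ h
        exact ⟨b, rfl⟩
      obtain ⟨q, hq⟩ := (Set.range_list_map (Sigma.mk i : V i → _)).ge hp
      exact ⟨q, hq.symm⟩
    rw [hq] at hc hn hl
    refine le_trans ?_ (Finset.le_sup (f := fun i => (G i).longestPathLength) (Finset.mem_univ i))
    refine IsPathOfLength.le_longestPathLength (p := q) ⟨?_, hn.of_map _, by simpa using hl⟩
    exact List.isChain_of_isChain_map _ (fun a b h => disjointUnion_adj_mk.1 h) hc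
  · refine Finset.sup_le fun i _ => ?_
    obtain ⟨p, hc, hn, hl⟩ := exists_longest_path (G i)
    refine IsPathOfLength.le_longestPathLength (p := p.map (Sigma.mk i)) ⟨?_, ?_, by simpa⟩
    · exact List.isChain_map_of_isChain _ (fun a b h => disjointUnion_adj_mk.2 h) hc
    · exact hn.map sigma_mk_injective

end Digraph

/-! ### Oriented co-graphs as strict partial orders -/

theorem IsOrientedCograph.nonempty {V : Type u} {G : Digraph V} (h : IsOrientedCograph G) :
    Nonempty V := by
  induction h with
  | single => exact ⟨default⟩
  | union hk _ _ ih => exact ⟨⟨⟨0, hk⟩, (ih _).some⟩⟩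
  | order hk _ _ ih => exact ⟨⟨⟨0, hk⟩, (ih _).some⟩⟩
  | iso e _ ih => exact ih.map e

theorem IsOrientedCograph.irrefl {V : Type u} {G : Digraph V} (h : IsOrientedCograph G) (v : V) :
    ¬ G.Adj v v := by
  induction h with
  | single G h => exact h v v
  | union _ G _ ih =>
    obtain ⟨i, a⟩ := v
    rw [Digraph.disjointUnion_adj_mk]
    exact ih i a
  | order _ G _ ih =>
    obtain ⟨i, a⟩ := v
    rw [Digraph.orderComposition_adj_mk]
    exact ih i a
  | iso e _ ih =>
    intro h
    exact ih (e.symm v) (e.symm.map_rel_iff.2 h)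

theorem IsOrientedCograph.trans {V : Type u} {G : Digraph V} (h : IsOrientedCograph G)
    {x y z : V} (hxy : G.Adj x y) (hyz : G.Adj y z) : G.Adj x z := by
  induction h with
  | single G h => exact absurd hxy (h _ _)
  | union _ G _ ih =>
    obtain ⟨i, a, b, h, rfl, rfl⟩ := hxy
    obtain ⟨_, c⟩ := z
    obtain rfl := Digraph.disjointUnion_adj_fst hyz
    rw [Digraph.disjointUnion_adj_mk] at hyz ⊢
    exact ih i h hyz
  | order _ G _ ih =>
    rcases hxy with hxy | hxy
    · rcases hyz with hyz | hyz
      · obtain ⟨i, a, b, h, rfl, rfl⟩ := hxy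
        obtain ⟨_, c⟩ := z
        obtain rfl := Digraph.disjointUnion_adj_fst hyz
        rw [Digraph.disjointUnion_adj_mk] at hyz
        rw [Digraph.orderComposition_adj_mk]
        exact ih i h hyz
      · exact Or.inr ((Digraph.disjointUnion_adj_fst hxy).trans_lt hyz)
    · rcases hyz with hyz | hyz
      · exact Or.inr (hxy.trans_eq (Digraph.disjointUnion_adj_fst hyz))
      · exact Or.inr (lt_trans hxy hyz)
  | iso e _ ih =>
    exact e.symm.map_rel_iff.1 (ih (e.symm.map_rel_iff.2 hxy) (e.symm.map_rel_iff.2 hyz))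

/-! ### Program logic with time bounds -/

namespace RAM

theorem State.setReg_reg (σ : State) (r x : ℕ) : (σ.setReg r x).reg = Function.update σ.reg r x :=
  rfl

theorem State.setReg_mem (σ : State) (r x : ℕ) : (σ.setReg r x).mem = σ.mem := rfl

theorem State.setMem_mem (σ : State) (a x : ℕ) : (σ.setMem a x).mem = Function.update σ.mem a x :=
  rfl

theorem State.setMem_reg (σ : State) (a x : ℕ) : (σ.setMem a x).reg = σ.reg := rfl

/-- With word capacity `W`, the program `P` started in `σ` halts within `T` steps in a state that
satisfies `Q`. -/
def Run (W : ℕ) (P : Program) (σ : State) (T : ℕ) (Q : State → Prop) : Prop :=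
  ∃ t σ', Exec W P σ t σ' ∧ t ≤ T ∧ Q σ'

namespace Run

variable {W T : ℕ} {P P' : Program} {σ : State} {Q : State → Prop} {r s t : ℕ}

theorem mono {T' : ℕ} {Q' : State → Prop} (h : Run W P σ T Q) (hT : T ≤ T')
    (hQ : ∀ σ', Q σ' → Q' σ') : Run W P σ T' Q' := by
  obtain ⟨u, σ', h, hu, hq⟩ := h
  exact ⟨u, σ', h, hu.trans hT, hQ _ hq⟩

theorem seq {T' : ℕ} {R : State → Prop} (h : Run W P σ T R)
    (h' : ∀ σ', R σ' → Run W P' σ' T' Q) : Run W (.seq P P') σ (T + T') Q := by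
  obtain ⟨u, σ', h, hu, hr⟩ := h
  obtain ⟨u', σ'', h', hu', hq⟩ := h' σ' hr
  exact ⟨_, _, .seq h h', by omega, hq⟩

theorem seq_of_exec {σ' : State} (h : Exec W P σ 1 σ') (h' : Run W P' σ' T Q) :
    Run W (.seq P P') σ (T + 1) Q := by
  obtain ⟨u, σ'', h', hu, hq⟩ := h'
  exact ⟨_, _, .seq h h', by omega, hq⟩

theorem const_seq (k : ℕ) (hW : k ≤ W) (h : Run W P (σ.setReg r k) T Q) :
    Run W (.seq (.const r k) P) σ (T + 1) Q :=
  seq_of_exec (.const hW) h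

/-- Naming the operands by equations keeps the successor state free of nested register lookups
during symbolic execution. -/
theorem plus_seq (x y : ℕ) (hx : σ.reg s = x) (hy : σ.reg t = y) (hW : x + y ≤ W)
    (h : Run W P (σ.setReg r (x + y)) T Q) : Run W (.seq (.plus r s t) P) σ (T + 1) Q := by
  subst hx hy
  exact seq_of_exec (.plus hW) h

theorem minus_seq (x y : ℕ) (hx : σ.reg s = x) (hy : σ.reg t = y) (hW : x - y ≤ W)
    (h : Run W P (σ.setReg r (x - y)) T Q) : Run W (.seq (.minus r s t) P) σ (T + 1) Q := by
  subst hx hy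
  exact seq_of_exec (.minus hW) h

theorem load_seq (a x : ℕ) (ha : σ.reg s = a) (hx : σ.mem a = x) (haW : a ≤ W) (hxW : x ≤ W)
    (h : Run W P (σ.setReg r x) T Q) : Run W (.seq (.load r s) P) σ (T + 1) Q := by
  subst ha hx
  exact seq_of_exec (.load haW hxW) h

theorem store_seq (a x : ℕ) (ha : σ.reg r = a) (hx : σ.reg s = x) (haW : a ≤ W) (hxW : x ≤ W)
    (h : Run W P (σ.setMem a x) T Q) : Run W (.seq (.store r s) P) σ (T + 1) Q := by
  subst ha hx
  exact seq_of_exec (.store haW hxW) h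

theorem plus (x y : ℕ) (hx : σ.reg s = x) (hy : σ.reg t = y) (hW : x + y ≤ W)
    (h : Q (σ.setReg r (x + y))) : Run W (.plus r s t) σ 1 Q := by
  subst hx hy
  exact ⟨_, _, .plus hW, le_rfl, h⟩

theorem const (k : ℕ) (hW : k ≤ W) (h : Q (σ.setReg r k)) : Run W (.const r k) σ 1 Q :=
  ⟨_, _, .const hW, le_rfl, h⟩

theorem load (a x : ℕ) (ha : σ.reg s = a) (hx : σ.mem a = x) (haW : a ≤ W) (hxW : x ≤ W)
    (h : Q (σ.setReg r x)) : Run W (.load r s) σ 1 Q := by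
  subst ha hx
  exact ⟨_, _, .load haW hxW, le_rfl, h⟩

theorem ifLt (h : σ.reg r < σ.reg s → Run W P σ T Q) (h' : ¬ σ.reg r < σ.reg s → Run W P' σ T Q) :
    Run W (.ifLt r s P P') σ (T + 1) Q := by
  by_cases hc : σ.reg r < σ.reg s
  · obtain ⟨u, σ', h, hu, hq⟩ := h hc
    exact ⟨_, _, .ifTrue hc h, by omega, hq⟩
  · obtain ⟨u, σ', h, hu, hq⟩ := h' hc
    exact ⟨_, _, .ifFalse hc h, by omega, hq⟩

/-- The rule for loops: `I T` is an invariant that allows for at most `T` more steps. -/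
theorem whileLt (I : ℕ → State → Prop)
    (step : ∀ T σ, I T σ → σ.reg r < σ.reg s →
      ∃ T₁ T₂, T₁ + T₂ + 1 ≤ T ∧ Run W P σ T₁ (I T₂))
    (post : ∀ T σ, I T σ → ¬ σ.reg r < σ.reg s → 1 ≤ T ∧ Q σ) (h : I T σ) :
    Run W (.whileLt r s P) σ T Q := by
  induction T using Nat.strong_induction_on generalizing σ with
  | _ T ih =>
    by_cases hc : σ.reg r < σ.reg s
    · obtain ⟨T₁, T₂, hT, u, σ', he, hu, hi⟩ := step T σ h hc
      obtain ⟨u', σ'', he', hu', hq⟩ := ih T₂ (by omega) hi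
      exact ⟨_, _, .whileTrue hc he he', by omega, hq⟩
    · obtain ⟨hT, hq⟩ := post T σ h hc
      exact ⟨_, _, .whileFalse hc, hT, hq⟩

/-- The rule for loops whose body increases a counter and takes `B` steps. -/
theorem whileLt_counter {m : ℕ} (B : ℕ) (I : ℕ → State → Prop)
    (cond : ∀ i σ, I i σ → (σ.reg r < σ.reg s ↔ i < m))
    (step : ∀ i σ, i < m → I i σ → Run W P σ B (I (i + 1)))
    (h : I 0 σ) : Run W (.whileLt r s P) σ ((B + 1) * m + 1) (I m) := by
  -- Each remaining round costs `B` for the body and 1 for the test; the last summand pays for the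
  -- failing test.
  refine whileLt (fun T σ => ∃ i ≤ m, I i σ ∧ T = (B + 1) * (m - i) + 1) ?_ ?_
    ⟨0, Nat.zero_le m, h, by simp⟩
  · rintro _ σ ⟨i, -, hi, rfl⟩ hc
    have him := (cond i σ hi).1 hc
    refine ⟨B, (B + 1) * (m - (i + 1)) + 1, ?_, (step i σ him hi).mono le_rfl
      fun σ' h' => ⟨i + 1, him, h', rfl⟩⟩
    obtain ⟨e, rfl⟩ := Nat.exists_eq_add_of_lt him
    have h₁ : i + e + 1 - i = e + 1 := by omega
    have h₂ : i + e + 1 - (i + 1) = e := by omega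
    rw [h₁, h₂]
    linarith
  · rintro _ σ ⟨i, hi, hI, rfl⟩ hc
    rw [cond i σ hI] at hc
    obtain rfl : i = m := by omega
    exact ⟨by omega, hI⟩

end Run

end RAM

/-! ## Longest walks by relaxation of sorted arcs -/

/-- There is a walk of length `k` ending in `v` along the arcs `(U i, V i)`, `i < m`. -/
inductive WalkTo (m : ℕ) (U V : ℕ → ℕ) : ℕ → ℕ → Prop
  | nil (v : ℕ) : WalkTo m U V v 0
  | snoc {i k : ℕ} (hi : i < m) (h : WalkTo m U V (U i) k) : WalkTo m U V (V i) (k + 1)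

/-- The state of the relaxation when the arcs in `R` remain to be relaxed. -/
structure Relaxed (n m : ℕ) (U V : ℕ → ℕ) (R : Finset ℕ) (d : ℕ → ℕ) (best : ℕ) : Prop where
  walk : ∀ v < n, WalkTo m U V v (d v)
  le_best : ∀ v < n, d v ≤ best
  best_walk : ∃ v < n, WalkTo m U V v best
  best_le : best + R.card ≤ m
  relaxed : ∀ j < m, j ∉ R → d (U j) + 1 ≤ d (V j)

namespace Relaxed

variable {n m : ℕ} {U V : ℕ → ℕ} {R : Finset ℕ} {d : ℕ → ℕ} {best : ℕ}

theorem start (hn : 0 < n) (hd : ∀ v < n, d v = 0) :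
    Relaxed n m U V (Finset.range m) d 0 where
  walk v hv := by
    rw [hd v hv]
    exact .nil v
  le_best v hv := (hd v hv).le
  best_walk := ⟨0, hn, .nil 0⟩
  best_le := by simp
  relaxed j hj hR := absurd (Finset.mem_range.2 hj) hR

/-- Raising `d (V j)` can only spoil inequalities of relaxed arcs with tail `V j`, and `hlast`
excludes these. The form `a + (b - a)` is the maximum, expressed by the instructions of the machine.
Since `best` grows by at most one while `R` loses an arc, `best_le` survives. -/
theorem step (h : Relaxed n m U V R d best) (hU : ∀ i < m, U i < n) (hV : ∀ i < m, V i < n)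
    {j : ℕ} (hj : j < m) (hjR : j ∈ R) (hne : U j ≠ V j)
    (hlast : ∀ i < m, i ∉ R → U i ≠ V j) {d' : ℕ → ℕ} {best' : ℕ}
    (hd : d' (V j) = d (V j) + (d (U j) + 1 - d (V j))) (hd' : ∀ v < n, v ≠ V j → d' v = d v)
    (hb : best' = best + (d (U j) + 1 - best)) :
    Relaxed n m U V (R.erase j) d' best' := by
  have hcard := Finset.card_erase_add_one hjR
  have hle := h.best_le
  have huv : WalkTo m U V (V j) (d (U j) + 1) := .snoc hj (h.walk _ (hU j hj))
  have hub := h.le_best _ (hU j hj)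
  have hvb := h.le_best _ (hV j hj)
  refine ⟨fun v hv => ?_, fun v hv => ?_, ?_, by omega, fun i hi hiR => ?_⟩
  · by_cases hvj : v = V j
    · subst hvj
      rw [hd]
      rcases le_total (d (U j) + 1) (d (V j)) with hle | hle
      · rw [Nat.sub_eq_zero_of_le hle]
        exact h.walk _ hv
      · rw [Nat.add_sub_of_le hle]
        exact huv
    · rw [hd' v hv hvj]
      exact h.walk v hv
  · by_cases hvj : v = V j
    · subst hvj
      omega
    · rw [hd' v hv hvj]
      have := h.le_best v hv
      omega
  · rcases le_total (d (U j) + 1) best with hle | hle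
    · rw [hb, Nat.sub_eq_zero_of_le hle]
      exact h.best_walk
    · rw [hb, Nat.add_sub_of_le hle]
      exact ⟨V j, hV j hj, huv⟩
  · by_cases hij : i = j
    · subst hij
      rw [hd' _ (hU i hi) hne]
      omega
    · have hiR : i ∉ R := fun hm => hiR (Finset.mem_erase.2 ⟨hij, hm⟩)
      have h₁ := h.relaxed i hi hiR
      rw [hd' _ (hU i hi) (hlast i hi hiR)]
      by_cases hvj : V i = V j
      · rw [hvj] at h₁ ⊢
        omega
      · rwa [hd' _ (hV i hi) hvj]

/-- Once every arc is relaxed, `d` grows by at least one along each arc, so `d v` bounds every walk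
ending in `v`. -/
theorem finish (h : Relaxed n m U V ∅ d best) :
    (∃ v < n, WalkTo m U V v best) ∧ ∀ v < n, ∀ k, WalkTo m U V v k → k ≤ best := by
  refine ⟨h.best_walk, fun v hv k hk => le_trans ?_ (h.le_best v hv)⟩
  clear hv
  induction hk with
  | nil => exact Nat.zero_le _
  | snoc hi _ ih => exact le_trans (Nat.succ_le_succ ih) (h.relaxed _ hi (by simp))

end Relaxed

/-! ## Linked lists of arcs -/

/-- The pointer `p` leads to a linked list of the arcs in the given list, where the arc `j`
has the address `2 + 2 * j`, the end is marked by `0`, and `next` gives the successors. -/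
def Linked (next : ℕ → ℕ) : ℕ → List ℕ → Prop
  | p, [] => p = 0
  | p, j :: l => p = 2 + 2 * j ∧ Linked next (next p) l

theorem Linked.congr {next next' : ℕ → ℕ} {p : ℕ} {l : List ℕ} (h : Linked next p l)
    (hn : ∀ j ∈ l, next' (2 + 2 * j) = next (2 + 2 * j)) : Linked next' p l := by
  induction l generalizing p with
  | nil => exact h
  | cons j l ih =>
    obtain ⟨rfl, h⟩ := h
    refine ⟨rfl, ?_⟩
    rw [hn j (by simp)]
    exact ih h fun i hi => hn i (by simp [hi])

/-! ### The program and its correctness -/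

namespace LongestPath

open RAM

/-- Reads `n` and `m` and sets up the constants. With `S = 2 * m + 2 + n`, the cells from `S` on
are for the indegrees, those from `2 * S` on for the lists of arcs by the indegree of the tail,
those from `3 * S` on for the successors in these lists, and those from `4 * S` on for the
lengths of the longest walks found. -/
def setupProgram : Program :=
  .seq (.const 7 1) <| .seq (.load 1 9) <| .seq (.load 2 7) <| .seq (.plus 8 2 2) <|
  .seq (.plus 8 8 7) <| .seq (.plus 8 8 7) <| .seq (.plus 3 8 1) <| .seq (.plus 4 3 3) <|
  .seq (.plus 5 4 3) <| .seq (.plus 6 5 3) <| .const 10 2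

/-- Counts the arc at address `R[10]` for the indegree of its head. -/
def countBody : Program :=
  .seq (.plus 11 10 7) <| .seq (.load 11 11) <| .seq (.plus 11 3 11) <| .seq (.load 12 11) <|
  .seq (.plus 12 12 7) <| .seq (.store 11 12) <| .seq (.plus 10 10 7) <| .plus 10 10 7

/-- Puts the arc at address `R[10]` into the list for the indegree of its tail. -/
def bucketBody : Program :=
  .seq (.load 11 10) <| .seq (.plus 11 3 11) <| .seq (.load 11 11) <| .seq (.plus 11 4 11) <|
  .seq (.load 12 11) <| .seq (.plus 13 5 10) <| .seq (.store 13 12) <| .seq (.store 11 10) <|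
  .seq (.plus 10 10 7) <| .plus 10 10 7

/-- Relaxes the arc at address `R[11]` and goes to its successor. -/
def relaxBody : Program :=
  .seq (.load 12 11) <| .seq (.plus 13 11 7) <| .seq (.load 13 13) <| .seq (.plus 12 6 12) <|
  .seq (.load 12 12) <| .seq (.plus 12 12 7) <| .seq (.plus 13 6 13) <| .seq (.load 14 13) <|
  .seq (.minus 15 12 14) <| .seq (.plus 14 14 15) <| .seq (.store 13 14) <|
  .seq (.minus 15 12 0) <| .seq (.plus 0 0 15) <| .seq (.plus 11 5 11) <| .load 11 11

/-- Goes to the list for the next indegree. -/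
def nextBody : Program :=
  .seq (.plus 10 10 7) <| .seq (.plus 11 4 10) <| .load 11 11

/-- Computes the length of a longest path of an oriented co-graph. -/
def program : Program :=
  .seq setupProgram <| .seq (.whileLt 10 8 countBody) <| .seq (.const 10 2) <|
  .seq (.whileLt 10 8 bucketBody) <| .seq (.const 10 0) <| .seq (.load 11 4) <|
  .whileLt 10 1 (.ifLt 9 11 relaxBody nextBody)

/-- The registers hold the constants, and the arcs stand in their memory cells. -/
structure Setup (n m : ℕ) (U V : ℕ → ℕ) (σ : State) : Prop where
  r1 : σ.reg 1 = n
  r3 : σ.reg 3 = 2 * m + 2 + n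
  r4 : σ.reg 4 = 2 * (2 * m + 2 + n)
  r5 : σ.reg 5 = 3 * (2 * m + 2 + n)
  r6 : σ.reg 6 = 4 * (2 * m + 2 + n)
  r7 : σ.reg 7 = 1
  r8 : σ.reg 8 = 2 * m + 2
  r9 : σ.reg 9 = 0
  tail : ∀ i < m, σ.mem (2 + 2 * i) = U i
  head : ∀ i < m, σ.mem (2 + 2 * i + 1) = V i

variable {n m W : ℕ} {U V : ℕ → ℕ} {σ : State}

theorem Setup.setReg (h : Setup n m U V σ) {r : ℕ} (hr : 10 ≤ r) (x : ℕ) :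
    Setup n m U V (σ.setReg r x) := by
  constructor
  case tail => exact h.tail
  case head => exact h.head
  all_goals
    rw [State.setReg_reg, Function.update_of_ne (by omega)]
  exacts [h.r1, h.r3, h.r4, h.r5, h.r6, h.r7, h.r8, h.r9]

theorem Setup.setReg_zero (h : Setup n m U V σ) (x : ℕ) : Setup n m U V (σ.setReg 0 x) := by
  constructor
  case tail => exact h.tail
  case head => exact h.head
  all_goals
    rw [State.setReg_reg, Function.update_of_ne (by omega)]
  exacts [h.r1, h.r3, h.r4, h.r5, h.r6, h.r7, h.r8, h.r9]

theorem Setup.setMem (h : Setup n m U V σ) {a : ℕ} (ha : 2 * m + 2 ≤ a) (x : ℕ) :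
    Setup n m U V (σ.setMem a x) := by
  refine ⟨h.r1, h.r3, h.r4, h.r5, h.r6, h.r7, h.r8, h.r9, fun i hi => ?_, fun i hi => ?_⟩
  · rw [State.setMem_mem, Function.update_of_ne (by omega)]
    exact h.tail i hi
  · rw [State.setMem_mem, Function.update_of_ne (by omega)]
    exact h.head i hi

/-- The indegree of `v`. -/
def indeg (m : ℕ) (V : ℕ → ℕ) (v : ℕ) : ℕ := Nat.count (fun j => V j = v) m

theorem indeg_le (m : ℕ) (V : ℕ → ℕ) (v : ℕ) : indeg m V v ≤ m := Nat.count_le _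

theorem indeg_succ (m : ℕ) (V : ℕ → ℕ) (v : ℕ) :
    indeg (m + 1) V v = indeg m V v + if V m = v then 1 else 0 := Nat.count_succ _ _

/-- The state after the first `i` arcs have been counted. -/
structure Counted (n m : ℕ) (U V : ℕ → ℕ) (i : ℕ) (σ : State) : Prop where
  setup : Setup n m U V σ
  r0 : σ.reg 0 = 0
  r10 : σ.reg 10 = 2 + 2 * i
  deg : ∀ v < n, σ.mem (2 * m + 2 + n + v) = indeg i V v
  zero : ∀ a, 2 * (2 * m + 2 + n) ≤ a → σ.mem a = 0

theorem run_countBody (hW : 5 * (2 * m + 2 + n) ≤ W) (hV : ∀ i < m, V i < n) {i : ℕ} (hi : i < m)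
    (h : Counted n m U V i σ) : Run W countBody σ 8 (Counted n m U V (i + 1)) := by
  have hVi := hV i hi
  have hd := indeg_le i V (V i)
  refine Run.plus_seq (2 + 2 * i) 1 h.r10 h.setup.r7 (by omega) ?_
  refine Run.load_seq (2 + 2 * i + 1) (V i) (by simp [State.setReg_reg]) (h.setup.head i hi)
    (by omega) (by omega) ?_
  refine Run.plus_seq (2 * m + 2 + n) (V i) (by simp [State.setReg_reg, h.setup.r3])
    (by simp [State.setReg_reg]) (by omega) ?_
  refine Run.load_seq (2 * m + 2 + n + V i) (indeg i V (V i)) (by simp [State.setReg_reg])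
    (h.deg _ hVi) (by omega) (by omega) ?_
  refine Run.plus_seq (indeg i V (V i)) 1 (by simp [State.setReg_reg])
    (by simp [State.setReg_reg, h.setup.r7]) (by omega) ?_
  refine Run.store_seq (2 * m + 2 + n + V i) (indeg i V (V i) + 1) (by simp [State.setReg_reg])
    (by simp [State.setReg_reg]) (by omega) (by omega) ?_
  refine Run.plus_seq (2 + 2 * i) 1 (by simp [State.setReg_reg, State.setMem_reg, h.r10])
    (by simp [State.setReg_reg, State.setMem_reg, h.setup.r7]) (by omega) ?_
  refine Run.plus (2 + 2 * i + 1) 1 (by simp [State.setReg_reg])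
    (by simp [State.setReg_reg, State.setMem_reg, h.setup.r7]) (by omega) ?_
  refine ⟨?_, ?_, ?_, fun v hv => ?_, fun a ha => ?_⟩
  -- From the outside: two increments of register 10, the store, and then five writes to scratch
  -- registers.
  · refine Setup.setReg (Setup.setReg (Setup.setMem ?_ (by omega) _) ?_ _) ?_ _
    · iterate 5 refine Setup.setReg ?_ (by omega) _
      exact h.setup
    all_goals omega
  · simp [State.setReg_reg, State.setMem_reg, h.r0]
  · simp [State.setReg_reg]
    omega
  · simp only [State.setReg_mem, State.setMem_mem, indeg_succ]
    by_cases hvi : V i = v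
    · subst hvi
      simp
    · rw [Function.update_of_ne (by omega), h.deg v hv, if_neg hvi, Nat.add_zero]
  · simp only [State.setReg_mem, State.setMem_mem]
    rw [Function.update_of_ne (by omega), h.zero a ha]

/-- The heads and successors in the memory `μ` describe the lists `L k`. -/
structure Buckets (n m : ℕ) (U V : ℕ → ℕ) (i : ℕ) (L : ℕ → List ℕ) (μ : ℕ → ℕ) : Prop where
  nodup : ∀ k, (L k).Nodup
  mem_iff : ∀ k j, j ∈ L k ↔ j < i ∧ indeg m V (U j) = k
  linked : ∀ k ≤ n, Linked (fun a => μ (3 * (2 * m + 2 + n) + a)) (μ (2 * (2 * m + 2 + n) + k)) (L k)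

/-- The state after the first `i` arcs have been put into their lists. -/
structure Bucketed (n m : ℕ) (U V : ℕ → ℕ) (i : ℕ) (σ : State) : Prop where
  setup : Setup n m U V σ
  r0 : σ.reg 0 = 0
  r10 : σ.reg 10 = 2 + 2 * i
  deg : ∀ v < n, σ.mem (2 * m + 2 + n + v) = indeg m V v
  zero : ∀ a, 4 * (2 * m + 2 + n) ≤ a → σ.mem a = 0
  buckets : ∃ L, Buckets n m U V i L σ.mem

/-- Used to show that loaded pointers fit into a word. -/
theorem Linked.le {next : ℕ → ℕ} {p : ℕ} {l : List ℕ} (h : Linked next p l) {b : ℕ}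
    (hl : ∀ j ∈ l, j < b) : p ≤ 2 * b := by
  rcases l with - | ⟨j, l⟩
  · have : p = 0 := h
    omega
  · have := hl j (by simp)
    have := h.1
    omega

/-- The two updates push `i` on the front of list `κ`: its successor becomes the old front, and the
front becomes its address. The blocks of cells are disjoint because `κ < n` and `2 + 2 * i < 2 * m +
2`. -/
theorem Buckets.insert {i : ℕ} {L : ℕ → List ℕ} {μ : ℕ → ℕ} (h : Buckets n m U V i L μ)
    (hi : i < m) {κ : ℕ} (hκ : indeg m V (U i) = κ) (hκn : κ < n) :
    Buckets n m U V (i + 1) (Function.update L κ (i :: L κ))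
      (Function.update (Function.update μ (3 * (2 * m + 2 + n) + (2 + 2 * i))
        (μ (2 * (2 * m + 2 + n) + κ))) (2 * (2 * m + 2 + n) + κ) (2 + 2 * i)) := by
  -- The old lists contain only arcs `j < i`, whose successor cells are not overwritten.
  have hcongr : ∀ k ≤ n, Linked (fun a => (Function.update (Function.update μ
      (3 * (2 * m + 2 + n) + (2 + 2 * i)) (μ (2 * (2 * m + 2 + n) + κ)))
      (2 * (2 * m + 2 + n) + κ) (2 + 2 * i)) (3 * (2 * m + 2 + n) + a))
      (μ (2 * (2 * m + 2 + n) + k)) (L k) := by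
    intro k hk
    refine (h.linked k hk).congr fun j hj => ?_
    have := ((h.mem_iff k j).1 hj).1
    rw [Function.update_of_ne (by omega), Function.update_of_ne (by omega)]
  refine ⟨fun k => ?_, fun k j => ?_, fun k hk => ?_⟩
  · by_cases hk : k = κ
    · subst hk
      simp only [Function.update_self, List.nodup_cons]
      exact ⟨fun hm => absurd ((h.mem_iff _ _).1 hm).1 (lt_irrefl i), h.nodup k⟩
    · rw [Function.update_of_ne hk]
      exact h.nodup k
  · by_cases hk : k = κ
    · subst hk
      simp only [Function.update_self, List.mem_cons, h.mem_iff]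
      constructor
      · rintro (rfl | ⟨h₁, h₂⟩)
        · exact ⟨Nat.lt_succ_self _, hκ⟩
        · exact ⟨by omega, h₂⟩
      · rintro ⟨h₁, h₂⟩
        rcases Nat.lt_succ_iff_lt_or_eq.1 h₁ with h₁ | h₁
        · exact Or.inr ⟨h₁, h₂⟩
        · exact Or.inl h₁
    · rw [Function.update_of_ne hk, h.mem_iff]
      constructor
      · rintro ⟨h₁, h₂⟩
        exact ⟨by omega, h₂⟩
      · rintro ⟨h₁, h₂⟩
        refine ⟨lt_of_le_of_ne (Nat.lt_succ_iff.1 h₁) ?_, h₂⟩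
        rintro rfl
        exact hk (h₂.symm.trans hκ)
  · by_cases hkκ : k = κ
    · subst hkκ
      rw [Function.update_self, Function.update_self]
      refine ⟨rfl, ?_⟩
      have := hcongr k hk
      convert this using 1
      simp only []
      rw [Function.update_of_ne (by omega), Function.update_self]
    · rw [Function.update_of_ne hkκ]
      have := hcongr k hk
      convert this using 1
      rw [Function.update_of_ne (by omega), Function.update_of_ne (by omega)]

theorem run_bucketBody (hW : 5 * (2 * m + 2 + n) ≤ W) (hU : ∀ i < m, U i < n)
    (hdeg : ∀ v < n, indeg m V v < n) {i : ℕ} (hi : i < m)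
    (h : Bucketed n m U V i σ) : Run W bucketBody σ 10 (Bucketed n m U V (i + 1)) := by
  have hUi := hU i hi
  have hd := hdeg _ hUi
  obtain ⟨L, hL⟩ := h.buckets
  obtain ⟨κ, hκ⟩ : ∃ κ, indeg m V (U i) = κ := ⟨_, rfl⟩
  rw [hκ] at hd
  have hx : σ.mem (2 * (2 * m + 2 + n) + κ) ≤ 2 * i :=
    Linked.le (hL.linked κ hd.le) fun j hj => ((hL.mem_iff _ _).1 hj).1
  refine Run.load_seq (2 + 2 * i) (U i) h.r10 (h.setup.tail i hi) (by omega) (by omega) ?_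
  refine Run.plus_seq (2 * m + 2 + n) (U i) (by simp [State.setReg_reg, h.setup.r3])
    (by simp [State.setReg_reg]) (by omega) ?_
  refine Run.load_seq (2 * m + 2 + n + U i) κ (by simp [State.setReg_reg])
    ((h.deg _ hUi).trans hκ) (by omega) (by omega) ?_
  refine Run.plus_seq (2 * (2 * m + 2 + n)) κ (by simp [State.setReg_reg, h.setup.r4])
    (by simp [State.setReg_reg]) (by omega) ?_
  refine Run.load_seq (2 * (2 * m + 2 + n) + κ) _ (by simp [State.setReg_reg]) rfl
    (by omega) (hx.trans (by omega)) ?_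
  simp only [State.setReg_mem]
  refine Run.plus_seq (3 * (2 * m + 2 + n)) (2 + 2 * i) (by simp [State.setReg_reg, h.setup.r5])
    (by simp [State.setReg_reg, h.r10]) (by omega) ?_
  refine Run.store_seq (3 * (2 * m + 2 + n) + (2 + 2 * i)) (σ.mem (2 * (2 * m + 2 + n) + κ))
    (by simp [State.setReg_reg]) (by simp [State.setReg_reg]) (by omega) (by omega) ?_
  refine Run.store_seq (2 * (2 * m + 2 + n) + κ) (2 + 2 * i)
    (by simp [State.setReg_reg, State.setMem_reg])
    (by simp [State.setReg_reg, State.setMem_reg, h.r10]) (by omega) (by omega) ?_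
  refine Run.plus_seq (2 + 2 * i) 1 (by simp [State.setReg_reg, State.setMem_reg, h.r10])
    (by simp [State.setReg_reg, State.setMem_reg, h.setup.r7]) (by omega) ?_
  refine Run.plus (2 + 2 * i + 1) 1 (by simp [State.setReg_reg])
    (by simp [State.setReg_reg, State.setMem_reg, h.setup.r7]) (by omega) ?_
  refine ⟨?_, ?_, ?_, fun v hv => ?_, fun a ha => ?_, _, hL.insert hi hκ hd⟩
  · refine Setup.setReg (Setup.setReg (Setup.setMem (Setup.setMem ?_ ?_ _) ?_ _) ?_ _) ?_ _
    · iterate 6 refine Setup.setReg ?_ (by omega) _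
      exact h.setup
    all_goals omega
  · simp [State.setReg_reg, State.setMem_reg, h.r0]
  · simp [State.setReg_reg]
    omega
  · simp only [State.setReg_mem, State.setMem_mem]
    rw [Function.update_of_ne (by omega), Function.update_of_ne (by omega), h.deg v hv]
  · simp only [State.setReg_mem, State.setMem_mem]
    rw [Function.update_of_ne (by omega), Function.update_of_ne (by omega), h.zero a ha]

/-- The state when, of the arcs whose tail has indegree at most `k`, only those in `l` remain to
be relaxed; the set of all remaining arcs is `R`. -/
structure Relaxing (n m : ℕ) (U V : ℕ → ℕ) (L : ℕ → List ℕ) (μ : ℕ → ℕ) (k : ℕ) (l : List ℕ)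
    (R : Finset ℕ) (σ : State) : Prop where
  setup : Setup n m U V σ
  mem_eq : ∀ a < 4 * (2 * m + 2 + n), σ.mem a = μ a
  buckets : Buckets n m U V m L μ
  le : k ≤ n
  r10 : σ.reg 10 = k
  linked : Linked (fun a => μ (3 * (2 * m + 2 + n) + a)) (σ.reg 11) l
  nodup : l.Nodup
  sub : ∀ j ∈ l, j < m ∧ indeg m V (U j) = k
  mem_iff : ∀ j, j ∈ R ↔ j < m ∧ (k < indeg m V (U j) ∨ j ∈ l)
  relaxed : Relaxed n m U V R (fun v => σ.mem (4 * (2 * m + 2 + n) + v)) (σ.reg 0)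

variable {L : ℕ → List ℕ} {μ : ℕ → ℕ} {k : ℕ} {l : List ℕ} {R : Finset ℕ}

/-- No arc leaves `R`: those with tail of indegree above `k` are those in bucket `k + 1` and those
above it. The case `k + 1 = n` reads one front beyond the possible indegrees, which is why
`Buckets.linked` includes `k = n`. -/
theorem run_nextBody (hW : 5 * (2 * m + 2 + n) ≤ W) (h : Relaxing n m U V L μ k [] R σ)
    (hk : k < n) : Run W nextBody σ 3 (Relaxing n m U V L μ (k + 1) (L (k + 1)) R) := by
  have hx : μ (2 * (2 * m + 2 + n) + (k + 1)) ≤ 2 * m :=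
    Linked.le (h.buckets.linked (k + 1) hk) fun j hj => ((h.buckets.mem_iff _ _).1 hj).1
  refine Run.plus_seq k 1 h.r10 h.setup.r7 (by omega) ?_
  refine Run.plus_seq (2 * (2 * m + 2 + n)) (k + 1) (by simp [State.setReg_reg, h.setup.r4])
    (by simp [State.setReg_reg]) (by omega) ?_
  refine Run.load (2 * (2 * m + 2 + n) + (k + 1)) _ (by simp [State.setReg_reg])
    (h.mem_eq _ (by omega)) (by omega) (by omega) ?_
  refine ⟨?_, h.mem_eq, h.buckets, hk, by simp [State.setReg_reg], ?_, h.buckets.nodup _, ?_, ?_,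
    ?_⟩
  · iterate 3 refine Setup.setReg ?_ (by omega) _
    exact h.setup
  · simpa [State.setReg_reg] using h.buckets.linked (k + 1) hk
  · exact fun j hj => (h.buckets.mem_iff _ _).1 hj
  · intro j
    rw [h.mem_iff, h.buckets.mem_iff]
    simp only [List.not_mem_nil, or_false]
    constructor
    · rintro ⟨h₁, h₂⟩
      refine ⟨h₁, ?_⟩
      omega
    · rintro ⟨h₁, h₂⟩
      refine ⟨h₁, ?_⟩
      omega
  · simpa [State.setReg_reg, State.setReg_mem] using h.relaxed

theorem run_relaxBody (hW : 5 * (2 * m + 2 + n) ≤ W) (hU : ∀ i < m, U i < n)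
    (hV : ∀ i < m, V i < n) (hlt : ∀ i < m, indeg m V (U i) < indeg m V (V i)) {j : ℕ}
    (h : Relaxing n m U V L μ k (j :: l) R σ) :
    Run W relaxBody σ 15 (Relaxing n m U V L μ k l (R.erase j)) := by
  obtain ⟨hj, hk⟩ := h.sub j (by simp)
  have hjR : j ∈ R := (h.mem_iff j).2 ⟨hj, .inr (by simp)⟩
  have hUj := hU j hj
  have hVj := hV j hj
  obtain ⟨hp, hnext⟩ := h.linked
  simp only [hp] at hnext
  -- With `best_le` this gives `best + 1 ≤ m`, so the new lengths fit into a word.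
  have hRpos := Finset.card_pos.2 ⟨j, hjR⟩
  have hbm := h.relaxed.best_le
  have hdU := h.relaxed.le_best _ hUj
  have hdV := h.relaxed.le_best _ hVj
  have hjl := List.nodup_cons.1 h.nodup
  have hx : μ (3 * (2 * m + 2 + n) + (2 + 2 * j)) ≤ 2 * m :=
    Linked.le hnext fun i hi => (h.sub i (by simp [hi])).1
  obtain ⟨x, hxe⟩ : ∃ x, σ.mem (4 * (2 * m + 2 + n) + U j) = x := ⟨_, rfl⟩
  obtain ⟨y, hye⟩ : ∃ y, σ.mem (4 * (2 * m + 2 + n) + V j) = y := ⟨_, rfl⟩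
  obtain ⟨b, hbe⟩ : ∃ b, σ.reg 0 = b := ⟨_, rfl⟩
  simp only [hxe, hye, hbe] at hbm hdU hdV
  refine Run.load_seq (2 + 2 * j) (U j) hp (h.setup.tail j hj) (by omega) (by omega) ?_
  refine Run.plus_seq (2 + 2 * j) 1 (by simp [State.setReg_reg, hp])
    (by simp [State.setReg_reg, h.setup.r7]) (by omega) ?_
  refine Run.load_seq (2 + 2 * j + 1) (V j) (by simp [State.setReg_reg]) (h.setup.head j hj)
    (by omega) (by omega) ?_
  refine Run.plus_seq (4 * (2 * m + 2 + n)) (U j) (by simp [State.setReg_reg, h.setup.r6])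
    (by simp [State.setReg_reg]) (by omega) ?_
  refine Run.load_seq (4 * (2 * m + 2 + n) + U j) x (by simp [State.setReg_reg]) hxe
    (by omega) (by omega) ?_
  refine Run.plus_seq x 1 (by simp [State.setReg_reg])
    (by simp [State.setReg_reg, h.setup.r7]) (by omega) ?_
  refine Run.plus_seq (4 * (2 * m + 2 + n)) (V j) (by simp [State.setReg_reg, h.setup.r6])
    (by simp [State.setReg_reg]) (by omega) ?_
  refine Run.load_seq (4 * (2 * m + 2 + n) + V j) y (by simp [State.setReg_reg]) hye
    (by omega) (by omega) ?_
  refine Run.minus_seq (x + 1) y (by simp [State.setReg_reg]) (by simp [State.setReg_reg])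
    (by omega) ?_
  refine Run.plus_seq y (x + 1 - y) (by simp [State.setReg_reg]) (by simp [State.setReg_reg])
    (by omega) ?_
  refine Run.store_seq (4 * (2 * m + 2 + n) + V j) (y + (x + 1 - y)) (by simp [State.setReg_reg])
    (by simp [State.setReg_reg]) (by omega) (by omega) ?_
  refine Run.minus_seq (x + 1) b (by simp [State.setReg_reg, State.setMem_reg])
    (by simp [State.setReg_reg, State.setMem_reg, hbe]) (by omega) ?_
  refine Run.plus_seq b (x + 1 - b) (by simp [State.setReg_reg, State.setMem_reg, hbe])
    (by simp [State.setReg_reg]) (by omega) ?_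
  refine Run.plus_seq (3 * (2 * m + 2 + n)) (2 + 2 * j)
    (by simp [State.setReg_reg, State.setMem_reg, h.setup.r5])
    (by simp [State.setReg_reg, State.setMem_reg, hp]) (by omega) ?_
  refine Run.load (3 * (2 * m + 2 + n) + (2 + 2 * j)) (μ (3 * (2 * m + 2 + n) + (2 + 2 * j)))
    (by simp [State.setReg_reg]) ?_ (by omega) (by omega) ?_
  · simp only [State.setReg_mem, State.setMem_mem]
    rw [Function.update_of_ne (by omega), h.mem_eq _ (by omega)]
  refine ⟨?_, fun a ha => ?_, h.buckets, h.le, ?_, ?_, hjl.2, fun i hi => h.sub i (by simp [hi]),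
    fun i => ?_, ?_⟩
  · refine Setup.setReg (Setup.setReg (Setup.setReg_zero (Setup.setReg (Setup.setMem ?_ ?_ _)
      ?_ _) _) ?_ _) ?_ _
    · iterate 10 refine Setup.setReg ?_ (by omega) _
      exact h.setup
    all_goals omega
  · simp only [State.setReg_mem, State.setMem_mem]
    rw [Function.update_of_ne (by omega), h.mem_eq a ha]
  · simp [State.setReg_reg, State.setMem_reg, h.r10]
  · simpa only [State.setReg_reg, Function.update_self] using hnext
  · rw [Finset.mem_erase, h.mem_iff, List.mem_cons]
    constructor
    · rintro ⟨h₁, h₂, h₃⟩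
      exact ⟨h₂, h₃.imp_right fun h => h.resolve_left h₁⟩
    · rintro ⟨h₁, h₂⟩
      refine ⟨?_, h₁, h₂.imp_right .inr⟩
      rintro rfl
      rcases h₂ with h₂ | h₂
      · omega
      · exact hjl.1 h₂
  · refine h.relaxed.step hU hV hj hjR ?_ ?_ ?_ ?_ ?_
    · intro he
      have := hlt j hj
      rw [he] at this
      exact lt_irrefl _ this
    -- An arc `i` leaving `V j` has a tail of indegree greater than `k`, hence it is still in `R`.
    · intro i hi hiR he
      have := hlt j hj
      rw [← he] at this
      exact hiR ((h.mem_iff i).2 ⟨hi, .inl (by omega)⟩)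
    · simp [State.setReg_mem, State.setMem_mem, hxe, hye]
    · intro v hv hvj
      simp only [State.setReg_mem, State.setMem_mem]
      rw [Function.update_of_ne (by omega)]
    · simp [State.setReg_reg, hxe, hbe]

/-- The potential `n - k + R.card` drops by one in every round, since a round either advances to the
next bucket or relaxes an arc. The factor 17 is 15 for the longer body plus one for each of the two
tests. -/
theorem run_relaxLoop (hW : 5 * (2 * m + 2 + n) ≤ W) (hU : ∀ i < m, U i < n)
    (hV : ∀ i < m, V i < n) (hdeg : ∀ v < n, indeg m V v < n)
    (hlt : ∀ i < m, indeg m V (U i) < indeg m V (V i))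
    (h : Relaxing n m U V L μ 0 l (Finset.range m) σ) :
    Run W (.whileLt 10 1 (.ifLt 9 11 relaxBody nextBody)) σ (17 * (n + m) + 1) fun σ' =>
      (∃ v < n, WalkTo m U V v (σ'.reg 0)) ∧
        ∀ v < n, ∀ k, WalkTo m U V v k → k ≤ σ'.reg 0 := by
  refine Run.whileLt (fun T σ => ∃ k l R, Relaxing n m U V L μ k l R σ ∧
    T = 17 * (n - k + R.card) + 1) ?_ ?_ ⟨0, l, _, h, by simp⟩
  · rintro _ σ ⟨k, l, R, h, rfl⟩ hc
    rw [h.r10, h.setup.r1] at hc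
    rcases l with - | ⟨j, l⟩
    · have hp : σ.reg 11 = 0 := h.linked
      refine ⟨15 + 1, 17 * (n - (k + 1) + R.card) + 1, by omega, Run.ifLt (fun hlt => ?_)
        fun _ => (run_nextBody hW h hc).mono (by omega) fun σ' h' => ⟨_, _, _, h', rfl⟩⟩
      omega
    · have hp : σ.reg 11 = 2 + 2 * j := h.linked.1
      have hjR : j ∈ R := (h.mem_iff j).2 ⟨(h.sub j (by simp)).1, .inr (by simp)⟩
      have hcard := Finset.card_erase_add_one hjR
      refine ⟨15 + 1, 17 * (n - k + (R.erase j).card) + 1, by omega, Run.ifLt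
        (fun _ => (run_relaxBody hW hU hV hlt h).mono le_rfl fun σ' h' => ⟨_, _, _, h', rfl⟩)
        fun hlt => ?_⟩
      have := h.setup.r9
      omega
  · rintro _ σ ⟨k, l, R, h, rfl⟩ hc
    rw [h.r10, h.setup.r1] at hc
    -- At the exit `k ≥ n`, while all indegrees of tails are below `n`.
    have hR : R = ∅ := by
      refine Finset.eq_empty_of_forall_notMem fun j hj => ?_
      obtain ⟨hjm, hj⟩ := (h.mem_iff j).1 hj
      have := hdeg _ (hU j hjm)
      rcases hj with hj | hj
      · omega
      · have := (h.sub j hj).2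
        omega
    have hr := h.relaxed
    rw [hR] at hr
    exact ⟨by omega, hr.finish⟩

theorem run_setupProgram (hn : 0 < n) (hW : 5 * (2 * m + 2 + n) ≤ W) (hreg : ∀ r, σ.reg r = 0)
    (h0 : σ.mem 0 = n) (h1 : σ.mem 1 = m) (htail : ∀ i < m, σ.mem (2 + 2 * i) = U i)
    (hhead : ∀ i < m, σ.mem (2 + 2 * i + 1) = V i) (hzero : ∀ a, 2 * m + 2 ≤ a → σ.mem a = 0) :
    Run W setupProgram σ 11 (Counted n m U V 0) := by
  refine Run.const_seq 1 (by omega) ?_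
  refine Run.load_seq 0 n (by simp [State.setReg_reg, hreg]) h0 (by omega) (by omega) ?_
  refine Run.load_seq 1 m (by simp [State.setReg_reg]) h1 (by omega) (by omega) ?_
  refine Run.plus_seq m m (by simp [State.setReg_reg]) (by simp [State.setReg_reg]) (by omega) ?_
  refine Run.plus_seq (m + m) 1 (by simp [State.setReg_reg]) (by simp [State.setReg_reg])
    (by omega) ?_
  refine Run.plus_seq (m + m + 1) 1 (by simp [State.setReg_reg]) (by simp [State.setReg_reg])
    (by omega) ?_
  refine Run.plus_seq (m + m + 1 + 1) n (by simp [State.setReg_reg]) (by simp [State.setReg_reg])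
    (by omega) ?_
  refine Run.plus_seq (m + m + 1 + 1 + n) (m + m + 1 + 1 + n) (by simp [State.setReg_reg])
    (by simp [State.setReg_reg]) (by omega) ?_
  refine Run.plus_seq (m + m + 1 + 1 + n + (m + m + 1 + 1 + n)) (m + m + 1 + 1 + n)
    (by simp [State.setReg_reg]) (by simp [State.setReg_reg]) (by omega) ?_
  refine Run.plus_seq (m + m + 1 + 1 + n + (m + m + 1 + 1 + n) + (m + m + 1 + 1 + n))
    (m + m + 1 + 1 + n) (by simp [State.setReg_reg]) (by simp [State.setReg_reg]) (by omega) ?_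
  refine Run.const 2 (by omega) ?_
  refine ⟨⟨?_, ?_, ?_, ?_, ?_, ?_, ?_, ?_, htail, hhead⟩, ?_, ?_, fun v hv => ?_, fun a ha =>
    hzero a (by omega)⟩
  all_goals simp [State.setReg_reg, State.setReg_mem, hreg]
  any_goals omega
  rw [hzero _ (by omega)]
  simp [indeg]

/-- The specification of the program in terms of the list `(U i, V i)`, `i < m`, of arcs. -/
theorem run_program (hn : 0 < n) (hW : 5 * (2 * m + 2 + n) ≤ W) (hU : ∀ i < m, U i < n)
    (hV : ∀ i < m, V i < n) (hdeg : ∀ v < n, indeg m V v < n)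
    (hlt : ∀ i < m, indeg m V (U i) < indeg m V (V i)) (hreg : ∀ r, σ.reg r = 0)
    (h0 : σ.mem 0 = n) (h1 : σ.mem 1 = m) (htail : ∀ i < m, σ.mem (2 + 2 * i) = U i)
    (hhead : ∀ i < m, σ.mem (2 + 2 * i + 1) = V i) (hzero : ∀ a, 2 * m + 2 ≤ a → σ.mem a = 0) :
    Run W program σ (60 * (n + m)) fun σ' =>
      (∃ v < n, WalkTo m U V v (σ'.reg 0)) ∧
        ∀ v < n, ∀ k, WalkTo m U V v k → k ≤ σ'.reg 0 := by
  -- The sum is `37 * m + 17 * n + 17`; `0 < n` absorbs the additive constant.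
  refine Run.mono (T := 11 + ((8 + 1) * m + 1 + (((10 + 1) * m + 1 + (17 * (n + m) + 1 + 1 + 1))
    + 1))) ?_ (by omega) fun _ => id
  refine Run.seq (run_setupProgram hn hW hreg h0 h1 htail hhead hzero) fun σ h => ?_
  refine Run.seq (Run.whileLt_counter 8 (Counted n m U V) (fun i σ h => ?_)
    (fun i σ hi h => run_countBody hW hV hi h) h) fun σ h => ?_
  · rw [h.r10, h.setup.r8]
    omega
  refine Run.const_seq 2 (by omega) ?_
  refine Run.seq (Run.whileLt_counter 10 (Bucketed n m U V) (fun i σ h => ?_)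
    (fun i σ hi h => run_bucketBody hW hU hdeg hi h) ?_) fun σ h => ?_
  · rw [h.r10, h.setup.r8]
    omega
  · refine ⟨h.setup.setReg (by omega) _, by simp [State.setReg_reg, h.r0],
      by simp [State.setReg_reg], h.deg, fun a ha => h.zero a (by omega), fun _ => [],
      fun k => List.nodup_nil, by simp, fun k _ => ?_⟩
    -- Untouched cells hold 0, which is the end mark, so all buckets start empty.
    exact h.zero _ (by omega)
  obtain ⟨L, hL⟩ := h.buckets
  have hx : σ.mem (2 * (2 * m + 2 + n)) ≤ 2 * m :=
    Linked.le (hL.linked 0 (by omega)) fun j hj => ((hL.mem_iff _ _).1 hj).1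
  refine Run.const_seq 0 (by omega) ?_
  refine Run.load_seq (2 * (2 * m + 2 + n)) _ (by simp [State.setReg_reg, h.setup.r4]) rfl
    (by omega) (hx.trans (by omega)) ?_
  refine run_relaxLoop (L := L) (μ := σ.mem) (l := L 0) hW hU hV hdeg hlt ?_
  refine ⟨(h.setup.setReg (by omega) _).setReg (by omega) _, fun _ _ => rfl, hL, Nat.zero_le n,
    by simp [State.setReg_reg], ?_, hL.nodup 0, fun j hj => (hL.mem_iff _ _).1 hj, fun j => ?_, ?_⟩
  · simpa [State.setReg_reg, State.setReg_mem] using hL.linked 0 (Nat.zero_le n)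
  · rw [Finset.mem_range, hL.mem_iff]
    omega
  · have := Relaxed.start (U := U) (V := V) (m := m) hn
      (d := fun v => σ.mem (4 * (2 * m + 2 + n) + v)) fun v _ => h.zero _ (by omega)
    simpa [State.setReg_reg, State.setReg_mem, h.r0] using this

end LongestPath

/-! ### From arc lists to digraphs -/

section ArcList

variable {n : ℕ} (arcs : List (Fin n × Fin n))

/-- The tail of the `i`-th arc. -/
def arcTail (i : ℕ) : ℕ := if h : i < arcs.length then (arcs[i].1 : ℕ) else 0

/-- The head of the `i`-th arc. -/
def arcHead (i : ℕ) : ℕ := if h : i < arcs.length then (arcs[i].2 : ℕ) else 0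

variable {arcs}

theorem arcTail_of_lt {i : ℕ} (h : i < arcs.length) : arcTail arcs i = arcs[i].1 := dif_pos h

theorem arcHead_of_lt {i : ℕ} (h : i < arcs.length) : arcHead arcs i = arcs[i].2 := dif_pos h

theorem getD_flatMap_pair {α : Type*} (f g : α → ℕ) (l : List α) :
    (∀ (i : ℕ) (h : i < l.length), (l.flatMap fun a => [f a, g a]).getD (2 * i) 0 = f l[i] ∧
      (l.flatMap fun a => [f a, g a]).getD (2 * i + 1) 0 = g l[i]) ∧
    ∀ i, 2 * l.length ≤ i → (l.flatMap fun a => [f a, g a]).getD i 0 = 0 := by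
  induction l with
  | nil => simp
  | cons a l ih =>
    constructor
    · rintro (- | i) h
      · simp
      · have := ih.1 i (by simpa using h)
        simpa [Nat.mul_add] using this
    · intro i hi
      obtain ⟨i, rfl⟩ : ∃ j, i = j + 2 := ⟨i - 2, by simp at hi; omega⟩
      have := ih.2 i (by simp at hi; omega)
      simpa using this

variable {G : Digraph (Fin n)}

/-- Sending an arc with head `v` to its tail is a bijection onto the in-neighbours of `v`; it is
injective because no arc is listed twice. -/
theorem indeg_arcHead [DecidableRel G.Adj] (hA : G.IsArcList arcs) (v : Fin n) :
    LongestPath.indeg arcs.length (arcHead arcs) v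
      = (Finset.univ.filter fun w => G.Adj w v).card := by
  rw [LongestPath.indeg, Nat.count_eq_card_filter_range]
  have hlt : ∀ j ∈ (Finset.range arcs.length).filter fun j => arcHead arcs j = v,
      ∃ h : j < arcs.length, arcs[j].2 = v := by
    intro j hj
    obtain ⟨h₁, h₂⟩ := Finset.mem_filter.1 hj
    have h₁ := Finset.mem_range.1 h₁
    rw [arcHead_of_lt h₁] at h₂
    exact ⟨h₁, Fin.ext h₂⟩
  refine Finset.card_bij (fun j hj => (arcs[j]'(hlt j hj).1).1) ?_ ?_ ?_
  · intro j hj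
    obtain ⟨h₁, h₂⟩ := hlt j hj
    simp only [Finset.mem_filter, Finset.mem_univ, true_and]
    have hadj := (hA.2 arcs[j].1 arcs[j].2).1 (List.getElem_mem h₁)
    rwa [h₂] at hadj
  · intro i hi j hj h
    obtain ⟨hi₁, hi₂⟩ := hlt i hi
    obtain ⟨hj₁, hj₂⟩ := hlt j hj
    exact (hA.1.getElem_inj_iff (hi := hi₁) (hj := hj₁)).1 (Prod.ext h (hi₂.trans hj₂.symm))
  · intro w hw
    obtain ⟨j, hj, hjw⟩ := List.mem_iff_getElem.1 ((hA.2 w v).2 (Finset.mem_filter.1 hw).2)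
    refine ⟨j, ?_, by simp [hjw]⟩
    rw [Finset.mem_filter, Finset.mem_range, arcHead_of_lt hj, hjw]
    exact ⟨hj, rfl⟩

/-- By irreflexivity `v` is not among its own in-neighbours. This bounds the number of buckets. -/
theorem IsOrientedCograph.indeg_lt (hG : IsOrientedCograph G) (hA : G.IsArcList arcs) {v : ℕ}
    (hv : v < n) : LongestPath.indeg arcs.length (arcHead arcs) v < n := by
  classical
  rw [indeg_arcHead hA ⟨v, hv⟩]
  conv_rhs => rw [← Fintype.card_fin n]
  refine Finset.card_lt_univ_of_notMem (x := ⟨v, hv⟩) ?_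
  simpa using hG.irrefl _

/-- By transitivity the in-neighbours of the tail, together with the tail itself, are in-neighbours
of the head; by irreflexivity the tail is a new one. -/
theorem IsOrientedCograph.indeg_lt_indeg (hG : IsOrientedCograph G) (hA : G.IsArcList arcs)
    {i : ℕ} (hi : i < arcs.length) :
    LongestPath.indeg arcs.length (arcHead arcs) (arcTail arcs i)
      < LongestPath.indeg arcs.length (arcHead arcs) (arcHead arcs i) := by
  classical
  rw [arcTail_of_lt hi, arcHead_of_lt hi, indeg_arcHead hA, indeg_arcHead hA]
  have hadj : G.Adj arcs[i].1 arcs[i].2 := (hA.2 _ _).1 (List.getElem_mem hi)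
  refine Finset.card_lt_card (Finset.ssubset_iff.2 ⟨arcs[i].1, ?_, ?_⟩)
  · simpa using hG.irrefl _
  · intro w hw
    rcases Finset.mem_insert.1 hw with rfl | hw
    · simpa using hadj
    · simpa using hG.trans (by simpa using hw) hadj

/-- Walks grow at their end and lists at their front, hence the reversed relation. -/
theorem exists_chain_of_walkTo (hA : G.IsArcList arcs) {v k : ℕ}
    (h : WalkTo arcs.length (arcTail arcs) (arcHead arcs) v k) (hv : v < n) :
    ∃ p : List (Fin n), (⟨v, hv⟩ :: p).IsChain (flip G.Adj) ∧ p.length = k := by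
  induction h with
  | nil => exact ⟨[], by simp⟩
  | @snoc i k hi _ ih =>
    obtain ⟨p, hp, hl⟩ := ih (by rw [arcTail_of_lt hi]; exact Fin.isLt _)
    refine ⟨_ :: p, List.isChain_cons_cons.2 ⟨?_, hp⟩, by simp [hl]⟩
    simp only [flip, arcTail_of_lt hi, arcHead_of_lt hi]
    exact (hA.2 _ _).1 (List.getElem_mem hi)

theorem walkTo_of_chain (hA : G.IsArcList arcs) (p : List (Fin n)) (v : Fin n)
    (h : (v :: p).IsChain (flip G.Adj)) :
    WalkTo arcs.length (arcTail arcs) (arcHead arcs) v p.length := by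
  induction p generalizing v with
  | nil => exact .nil _
  | cons w p ih =>
    obtain ⟨hwv, hp⟩ := List.isChain_cons_cons.1 h
    obtain ⟨j, hj, hjw⟩ := List.mem_iff_getElem.1 ((hA.2 w v).2 hwv)
    have hw := ih w hp
    have hs : WalkTo arcs.length (arcTail arcs) (arcHead arcs) (arcHead arcs j) (p.length + 1) :=
      .snoc hj (by rwa [arcTail_of_lt hj, hjw])
    rwa [arcHead_of_lt hj, hjw] at hs

/-- A chain of a strict order is pairwise related, hence free of repetitions, so every walk is a
path. -/
theorem IsOrientedCograph.eq_longestPathLength (hG : IsOrientedCograph G) (hA : G.IsArcList arcs)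
    {r : ℕ} (hr : ∃ v < n, WalkTo arcs.length (arcTail arcs) (arcHead arcs) v r)
    (hmax : ∀ v < n, ∀ k, WalkTo arcs.length (arcTail arcs) (arcHead arcs) v k → k ≤ r) :
    r = G.longestPathLength := by
  have := hG.nonempty
  have : IsTrans (Fin n) G.Adj := ⟨fun _ _ _ => hG.trans⟩
  have : Std.Irrefl G.Adj := ⟨hG.irrefl⟩
  apply le_antisymm
  · obtain ⟨v, hv, hw⟩ := hr
    obtain ⟨p, hp, hl⟩ := exists_chain_of_walkTo hA hw hv
    have hc : (⟨v, hv⟩ :: p).reverse.IsChain G.Adj := List.isChain_reverse.2 hp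
    exact Digraph.IsPathOfLength.le_longestPathLength (p := (⟨v, hv⟩ :: p).reverse)
      ⟨hc, (List.isChain_iff_pairwise.1 hc).nodup, by simp [hl]⟩
  · obtain ⟨p, hc, -, hl⟩ := G.exists_longest_path
    rcases hp : p.reverse with - | ⟨v, q⟩
    · have := congrArg List.length hp
      simp [hl] at this
    · have hlen := congrArg List.length hp
      simp only [List.length_reverse, List.length_cons, hl] at hlen
      have hc' : (v :: q).IsChain (flip G.Adj) := by
        rw [← hp]
        exact List.isChain_reverse.2 hc
      have := hmax v v.isLt _ (walkTo_of_chain hA q v hc')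
      omega

end ArcList

theorem mainTheorem9 :
    -- one program computes `ℓ(G)` for all oriented co-graphs `G` in time `O(|V| + |A|)`,
    -- on words of `O(log (|V| + |A|))` bits
    (∃ (P : RAM.Program) (c : ℕ), ∀ (n : ℕ) (G : Digraph (Fin n)), IsOrientedCograph G →
      ∀ arcs : List (Fin n × Fin n), G.IsArcList arcs →
        ∃ (t : ℕ) (σ : RAM.State),
          RAM.Exec (c * (n + arcs.length)) P (RAM.State.init (digraphInput n arcs)) t σ ∧
          t ≤ c * (n + arcs.length) ∧ σ.reg 0 = G.longestPathLength) ∧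
    -- `ℓ` of a disjoint union
    (∀ (k : ℕ) (_ : 1 ≤ k) (V : Fin k → Type u) [∀ i, Finite (V i)] [∀ i, Nonempty (V i)]
      (G : ∀ i, Digraph (V i)) (_ : ∀ i, (G i).IsOriented),
      (Digraph.disjointUnion G).longestPathLength =
        Finset.univ.sup fun i => (G i).longestPathLength) ∧
    -- `ℓ` of an order composition
    (∀ (k : ℕ) (_ : 1 ≤ k) (V : Fin k → Type u) [∀ i, Finite (V i)] [∀ i, Nonempty (V i)]
      (G : ∀ i, Digraph (V i)) (_ : ∀ i, (G i).IsOriented),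
      (Digraph.orderComposition G).longestPathLength =
        (∑ i, (G i).longestPathLength) + (k - 1)) := by
  -- The constant 60 serves both for the time and for the word capacity, which must be at least `5 *
  -- (2 * m + 2 + n)` to address all blocks of memory.
  refine ⟨⟨LongestPath.program, 60, fun n G hG arcs hA => ?_⟩,
    fun k hk V _ _ G _ => Digraph.longestPathLength_disjointUnion hk G,
    fun k hk V _ _ G _ => Digraph.longestPathLength_orderComposition hk G⟩
  have hn : 0 < n := Fin.pos_iff_nonempty.2 hG.nonempty
  have hinput := getD_flatMap_pair (fun a : Fin n × Fin n => (a.1 : ℕ)) (fun a => (a.2 : ℕ)) arcs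
  obtain ⟨t, σ, hE, ht, hr, hmax⟩ := LongestPath.run_program (n := n) (m := arcs.length)
    (U := arcTail arcs) (V := arcHead arcs) (W := 60 * (n + arcs.length))
    (σ := RAM.State.init (digraphInput n arcs)) hn (by omega)
    (fun i hi => by rw [arcTail_of_lt hi]; exact Fin.isLt _)
    (fun i hi => by rw [arcHead_of_lt hi]; exact Fin.isLt _)
    (fun v hv => hG.indeg_lt hA hv) (fun i hi => hG.indeg_lt_indeg hA hi)
    (fun _ => rfl) rfl rfl
    (fun i hi => by
      rw [arcTail_of_lt hi, Nat.add_comm, ← (hinput.1 i hi).1]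
      rfl)
    (fun i hi => by
      rw [arcHead_of_lt hi, Nat.add_comm 2, Nat.add_right_comm, ← (hinput.1 i hi).2]
      rfl)
    (fun a ha => by
      obtain ⟨a, rfl⟩ : ∃ b, a = b + 2 := ⟨a - 2, by omega⟩
      exact hinput.2 a (by omega))
  exact ⟨t, σ, hE, ht, hG.eq_longestPathLength hA hr hmax⟩
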